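/- Let $m\ge 1$ be an integer, $I=[0,1]$, and let $\mathcal U^m$ be the uniform distribution on $I^m$ (so the valuations $x_1,\dots,x_m$ of the $m$ goods are i.i.d. uniform on $I$). A selling mechanism is a pair of an allocation function $a:I^m\to I^m$ and a payment function $p:I^m\to[0,\infty)$. It is individually rational if $a(x)\cdot x-p(x)\ge 0$ for all $x\in I^m$, and incentive compatible if $a(x)\cdot x-p(x)\ge a(x')\cdot x-p(x')$ for all $x,x'\in I^m$. A feasible utility function on $I^m$ is a nonnegative convex function $u:I^m\to\mathbb R$ with $0\le \partial u/\partial x_j\le 1$ a.e. on $I^m$ for every $j$; its expected revenue is $R(u;\mathcal U^m)=\int_{I^m}\bigl(\nabla u(x)\cdot x-u(x)\bigr)\,dx$. Let $\mathrm{Rev}(\mathcal U^m)=\sup_u R(u;\mathcal U^m)$ be the optimal revenue, the supremum being over all feasible utility functions, and let $\mathrm{SRev}(\mathcal U^m)=\sum_{j=1}^m \mathrm{Rev}(\mathcal U^1)$ be the optimal revenue from selling the goods separately. **Theorem.** The optimal revenue from selling $m$ goods with i.i.d. uniform $[0,1]$ valuations satisfies $$\mathrm{Rev}(\mathcal U^m)\le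 \frac{m(1+m^2)}{2(1+m)^2}.$$ More precisely, for every feasible utility function $u$ the integrand of $R(u;\mathcal U^m)$ is integrable and $R(u;\mathcal U^m)$ is at most this bound, and for every individually rational and incentive compatible mechanism $(a,p)$ the payment $p$ is integrable and $\int_{I^m}p(x)\,dx$ is at most this bound. Moreover $\mathrm{SRev}(\mathcal U^m)=\frac m4$ and $$\frac{\mathrm{Rev}(\mathcal U^m)}{\mathrm{SRev}(\mathcal U^m)}\le \frac{2(1+m^2)}{(1+m)^2}<2 .$$ -/

import Mathlib

open MeasureTheory Set

noncomputable section

namespace GoodsMonopoly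

/-- A direct-revelation (randomized) selling mechanism for `m` goods, where the valuations lie in
the box `D = ∏ⱼ [Lⱼ, Hⱼ]`: an allocation function `D → [0,1]^m` and a payment function
`D → [0,∞)`.  (Only the values on the box `Set.Icc L H` matter.) -/
structure Mechanism {m : ℕ} (L H : Fin m → ℝ) where
  alloc : (Fin m → ℝ) → Fin m → ℝ
  pay : (Fin m → ℝ) → ℝ
  alloc_mem : ∀ x ∈ Icc L H, ∀ j, alloc x j ∈ Icc (0 : ℝ) 1
  pay_nonneg : ∀ x ∈ Icc L H, 0 ≤ pay x

namespace Mechanism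

variable {m : ℕ} {L H : Fin m → ℝ}

/-- Utility `u(x' | x)` of an additive buyer with true valuations `x` who reports `x'`. -/
def utility (M : Mechanism L H) (x' x : Fin m → ℝ) : ℝ :=
  ∑ j, M.alloc x' j * x j - M.pay x'

def IndividuallyRational (M : Mechanism L H) : Prop :=
  ∀ x ∈ Icc L H, 0 ≤ M.utility x x

def IncentiveCompatible (M : Mechanism L H) : Prop :=
  ∀ x ∈ Icc L H, ∀ x' ∈ Icc L H, M.utility x' x ≤ M.utility x x

/-- Expected payment when the valuations are independent with `xⱼ ∼ F j`. -/
def expectedPayment (M : Mechanism L H) (F : Fin m → Measure ℝ) : ℝ :=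
  ∫ x in Icc L H, M.pay x ∂(Measure.pi F)

end Mechanism

/-- The partial derivative `∂u/∂xⱼ` at `x`. -/
def partialDeriv {m : ℕ} (u : (Fin m → ℝ) → ℝ) (j : Fin m) (x : Fin m → ℝ) : ℝ :=
  lineDeriv ℝ u x (Pi.single j 1)

/-- The feasible utility functions on the box `D = ∏ⱼ [Lⱼ, Hⱼ]`: nonnegative convex functions on
`D` with `0 ≤ ∂u/∂xⱼ ≤ 1` almost everywhere in `D`, for every good `j`. -/
structure IsFeasibleUtility {m : ℕ} (L H : Fin m → ℝ) (u : (Fin m → ℝ) → ℝ) : Prop where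
  nonneg : ∀ x ∈ Icc L H, 0 ≤ u x
  convex : ConvexOn ℝ (Icc L H) u
  deriv_mem : ∀ j, ∀ᵐ x ∂(volume.restrict (Icc L H)), partialDeriv u j x ∈ Icc (0 : ℝ) 1

/-- The payment `∇u(x) · x - u(x)` of the mechanism that induces the utility function `u`. -/
def inducedPayment {m : ℕ} (u : (Fin m → ℝ) → ℝ) (x : Fin m → ℝ) : ℝ :=
  ∑ j, partialDeriv u j x * x j - u x

/-- The expected revenue `R(u; F) = ∫_D (∇u(x) · x - u(x)) dF(x)` for the product distribution
`F = F₁ × ⋯ × Fₘ` on the box `D`. -/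
def expectedRevenue {m : ℕ} (L H : Fin m → ℝ) (F : Fin m → Measure ℝ)
    (u : (Fin m → ℝ) → ℝ) : ℝ :=
  ∫ x in Icc L H, inducedPayment u x ∂(Measure.pi F)

/-- The optimal revenue `Rev(F) = sup_u R(u; F)` over the feasible utility functions. -/
def Rev {m : ℕ} (L H : Fin m → ℝ) (F : Fin m → Measure ℝ) : ℝ :=
  sSup {r | ∃ u, IsFeasibleUtility L H u ∧ r = expectedRevenue L H F u}

/-- The revenue from selling the goods separately, `SRev(F) = Rev(F₁) + ⋯ + Rev(Fₘ)`. -/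
def SRev {m : ℕ} (L H : Fin m → ℝ) (F : Fin m → Measure ℝ) : ℝ :=
  ∑ j, Rev (m := 1) (fun _ => L j) (fun _ => H j) (fun _ => F j)

/-- The uniform distribution on `[0,1]`. -/
def uniform01 : Measure ℝ := volume.restrict (Icc (0 : ℝ) 1)

instance : IsProbabilityMeasure uniform01 := ⟨by simp [uniform01]⟩

end GoodsMonopoly

end

/-!
A convex function on a box whose partial derivatives lie in `[0, 1]` almost everywhere is Lipschitz
on the interior, since the supporting hyperplanes at almost every point have bounded slope. Revenue
is therefore only ever computed for Lipschitz functions, where one may integrate by parts.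

The bound is weak duality for the linear program `max R(u)`. For each good `j` choose a function
`zⱼ` that rises from `0` to `1` along every line in direction `j`. Integrating by parts against
`xⱼ - zⱼ`, which vanishes at both ends of the line, gives
`∫ (xⱼ - zⱼ) ∂ⱼu + (1 - ∂ⱼzⱼ) u = 0`, and summing over `j`,
`R(u) = ∑ⱼ ∫ zⱼ ∂ⱼu + ∫ (∑ⱼ ∂ⱼzⱼ - (m + 1)) u`. If `zⱼ ≥ 0` and `∑ⱼ ∂ⱼzⱼ ≤ m + 1`, then
`∂ⱼu ≤ 1` and `u ≥ 0` yield `R(u) ≤ ∑ⱼ ∫ zⱼ`.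

The stated bound comes from letting `zⱼ` be the ramp ending at `xⱼ = 1` with slope `(m + 1) / k`,
where `k` counts `j` together with the other goods whose value exceeds `1 / (m + 1)`: a good below
that threshold has `zⱼ = 0`, so only the high goods contribute to `∑ⱼ ∂ⱼzⱼ`, each of them at most
`(m + 1) / k` with the same `k`, the number of high goods. For one good the bound is `1 / 4`, the
revenue from posting the price `1 / 2`.

The utility of truthful reporting is convex because it is a maximum of affine functions, and its
gradient is the allocation wherever it is differentiable; so mechanisms reduce to feasible
utilities.
-/

namespace GoodsMonopoly

open Filter Function Topology
open scoped NNReal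

section ConvexFunctions

variable {E : Type*} [NormedAddCommGroup E] [NormedSpace ℝ E] {s : Set E} {f : E → ℝ}

theorem add_fderiv_le_of_convexOn {f' : E →L[ℝ] ℝ} {x y : E} (hf : ConvexOn ℝ s f) (hx : x ∈ s)
    (hy : y ∈ s) (hf' : HasFDerivAt f f' x) : f x + f' (y - x) ≤ f y := by
  have hline : HasDerivAt (f ∘ AffineMap.lineMap x y) (f' (y - x)) (0 : ℝ) :=
    HasFDerivAt.comp_hasDerivAt 0 (by simpa using hf') AffineMap.hasDerivAt_lineMap
  have hslope := (hf.comp_affineMap (AffineMap.lineMap x y)).le_slope_of_hasDerivAt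
    (by simpa using hx) (by simpa using hy) zero_lt_one hline
  simp only [slope_def_field, comp_apply, AffineMap.lineMap_apply_zero,
    AffineMap.lineMap_apply_one, sub_zero, div_one] at hslope
  linarith

variable [FiniteDimensional ℝ E] [MeasurableSpace E] [BorelSpace E] {μ : Measure E}
  [μ.IsAddHaarMeasure]

theorem ae_mem_interior_of_convex (hs : Convex ℝ s) : ∀ᵐ x ∂μ.restrict s, x ∈ interior s := by
  rw [← Measure.restrict_congr_set
    (interior_ae_eq_of_null_frontier (hs.addHaar_frontier μ))]
  exact ae_restrict_mem isOpen_interior.measurableSet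

theorem ae_differentiableAt_of_convexOn (hf : ConvexOn ℝ s f) :
    ∀ᵐ x ∂μ.restrict s, DifferentiableAt ℝ f x := by
  suffices h : ∀ᵐ x ∂μ, ¬(x ∈ interior s ∧ ¬DifferentiableAt ℝ f x) by
    filter_upwards [ae_mem_interior_of_convex hf.1, ae_restrict_of_ae h] with x hxs hx
    exact not_not.1 fun hdiff => hx ⟨hxs, hdiff⟩
  refine measure_eq_zero_iff_ae_notMem.1 (measure_null_of_locally_null _ fun x hx => ?_)
  obtain ⟨K, t, ht, hLip⟩ := hf.locallyLipschitzOn_interior hx.1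
  rw [isOpen_interior.nhdsWithin_eq hx.1] at ht
  refine ⟨{y | ¬DifferentiableAt ℝ f y} ∩ interior t, ?_, ?_⟩
  · exact mem_nhdsWithin.2 ⟨interior t, isOpen_interior, mem_interior_iff_mem_nhds.2 ht,
      fun y hy => ⟨hy.2.2, hy.1⟩⟩
  · have hRademacher := (hLip.mono interior_subset).ae_differentiableWithinAt_of_mem (μ := μ)
    rw [ae_iff] at hRademacher
    refine measure_mono_null ?_ hRademacher
    rintro y ⟨hy, hyt⟩ hdiff
    exact hy ((hdiff hyt).differentiableAt (isOpen_interior.mem_nhds hyt))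

theorem lipschitzOnWith_interior_of_ae_norm_fderiv_le (hf : ConvexOn ℝ s f) {K : ℝ≥0}
    (hK : ∀ᵐ x ∂μ.restrict s, ‖fderiv ℝ f x‖ ≤ K) : LipschitzOnWith K f (interior s) := by
  refine .of_le_add_mul K fun x hx y hy => ?_
  have hae : (fun z => max (f z - (f y + K * dist z y)) 0) =ᵐ[μ.restrict (interior s)] 0 := by
    refine ae_restrict_of_ae_restrict_of_subset interior_subset ?_
    filter_upwards [hK, ae_differentiableAt_of_convexOn hf, ae_mem_interior_of_convex hf.1]
      with z hKz hdiff hz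
    have htangent := add_fderiv_le_of_convexOn hf (interior_subset hz) (interior_subset hy)
      hdiff.hasFDerivAt
    have hnorm : -(fderiv ℝ f z (y - z)) ≤ K * dist z y := by
      rw [dist_eq_norm']
      exact (neg_le_abs _).trans ((fderiv ℝ f z).le_of_opNorm_le hKz _)
    exact max_eq_right (by linarith)
  have hcont : ContinuousOn (fun z => max (f z - (f y + K * dist z y)) 0) (interior s) := by
    have := hf.continuousOn_interior
    fun_prop
  have hzero := Measure.eqOn_open_of_ae_eq hae isOpen_interior hcont continuousOn_const hx
  exact sub_nonpos.1 (max_eq_right_iff.1 hzero)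

end ConvexFunctions

section Update

variable {ι : Type*} [Fintype ι] [DecidableEq ι]

theorem measurePreserving_update {X : ι → Type*} [∀ i, MeasurableSpace (X i)]
    (μ : ∀ i, Measure (X i)) [∀ i, IsProbabilityMeasure (μ i)] (j : ι) :
    MeasurePreserving (fun p : (∀ i, X i) × X j => update p.1 j p.2)
      ((Measure.pi μ).prod (μ j)) (Measure.pi μ) := by
  have hmeas : Measurable fun p : (∀ i, X i) × X j => update p.1 j p.2 := measurable_update'
  refine ⟨hmeas, (Measure.pi_eq fun s hs => ?_).symm⟩
  have hpre : (fun p : (∀ i, X i) × X j => update p.1 j p.2) ⁻¹' univ.pi s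
      = univ.pi (update s j univ) ×ˢ s j := by
    ext p
    simp only [mem_preimage, mem_univ_pi, mem_prod, forall_update_iff s fun i S => p.1 i ∈ S,
      forall_update_iff p.1 fun i a => a ∈ s i, mem_univ, true_and, and_comm]
  have hprod : ∏ i ∈ Finset.univ.erase j, μ i (update s j univ i)
      = ∏ i ∈ Finset.univ.erase j, μ i (s i) :=
    Finset.prod_congr rfl fun i hi => by rw [update_of_ne (Finset.ne_of_mem_erase hi)]
  rw [Measure.map_apply hmeas (.univ_pi hs), hpre, Measure.prod_prod, Measure.pi_pi,
    ← Finset.prod_erase_mul _ _ (Finset.mem_univ j), hprod, update_self, measure_univ, mul_one,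
    Finset.prod_erase_mul _ (fun i => μ i (s i)) (Finset.mem_univ j)]

theorem integral_integral_update {X : ι → Type*} [∀ i, MeasurableSpace (X i)]
    (μ : ∀ i, Measure (X i)) [∀ i, IsProbabilityMeasure (μ i)] (j : ι)
    {E : Type*} [NormedAddCommGroup E] [NormedSpace ℝ E] {f : (∀ i, X i) → E}
    (hf : Integrable f (Measure.pi μ)) :
    ∫ x, ∫ t, f (update x j t) ∂μ j ∂Measure.pi μ = ∫ x, f x ∂Measure.pi μ := by
  have hupd := measurePreserving_update μ j
  rw [← hupd.map_eq] at hf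
  conv_rhs => rw [← hupd.map_eq, integral_map hupd.aemeasurable hf.1]
  exact (integral_prod _ (hf.comp_measurable hupd.measurable)).symm

theorem lipschitzWith_update {X : ι → Type*} [∀ i, PseudoEMetricSpace (X i)] (x : ∀ i, X i)
    (j : ι) : LipschitzWith 1 (update x j) := by
  intro a b
  rw [ENNReal.coe_one, one_mul, edist_pi_le_iff]
  intro i
  obtain rfl | hij := eq_or_ne i j
  · simp
  · simp [update_of_ne hij]

end Update

theorem deriv_comp_update {m : ℕ} (g : (Fin m → ℝ) → ℝ) (x : Fin m → ℝ) (j : Fin m) (t : ℝ) :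
    deriv (g ∘ update x j) t = partialDeriv g j (update x j t) := by
  have hline : ∀ r : ℝ, update x j t + r • Pi.single j 1 = update x j (t + r) := fun r => by
    ext i
    obtain rfl | hij := eq_or_ne i j <;> simp [*]
  simp only [partialDeriv, lineDeriv, hline]
  simpa using (deriv_comp_const_add (g ∘ update x j) t 0).symm

theorem fderiv_apply_eq_sum_partialDeriv {m : ℕ} {u : (Fin m → ℝ) → ℝ} {x : Fin m → ℝ}
    (hu : DifferentiableAt ℝ u x) (v : Fin m → ℝ) :
    fderiv ℝ u x v = ∑ j, v j * partialDeriv u j x := by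
  conv_lhs => rw [← Finset.univ_sum_single v, map_sum]
  refine Finset.sum_congr rfl fun j _ => ?_
  rw [partialDeriv, hu.lineDeriv_eq_fderiv, ← smul_eq_mul, ← map_smul, ← Pi.single_smul,
    smul_eq_mul, mul_one]

section FeasibleUtility

variable {m : ℕ} {L H : Fin m → ℝ} {u : (Fin m → ℝ) → ℝ}

theorem IsFeasibleUtility.ae_norm_fderiv_le (hu : IsFeasibleUtility L H u) :
    ∀ᵐ x ∂volume.restrict (Icc L H), ‖fderiv ℝ u x‖ ≤ m := by
  filter_upwards [ae_differentiableAt_of_convexOn hu.convex, ae_all_iff.2 hu.deriv_mem]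
    with x hdiff hpartial
  refine (fderiv ℝ u x).opNorm_le_bound m.cast_nonneg fun v => ?_
  calc ‖fderiv ℝ u x v‖ = ‖∑ j, v j * partialDeriv u j x‖ := by
        rw [fderiv_apply_eq_sum_partialDeriv hdiff]
    _ ≤ ∑ j, ‖v j * partialDeriv u j x‖ := norm_sum_le _ _
    _ ≤ ∑ _j : Fin m, ‖v‖ := Finset.sum_le_sum fun j _ => by
        rw [norm_mul, Real.norm_of_nonneg (hpartial j).1]
        exact (mul_le_of_le_one_right (norm_nonneg _) (hpartial j).2).trans (norm_le_pi_norm v j)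
    _ = m * ‖v‖ := by simp

theorem IsFeasibleUtility.exists_lipschitzWith_eventuallyEq (hu : IsFeasibleUtility L H u) :
    ∃ g, LipschitzWith m g ∧ ∀ᵐ x ∂volume.restrict (Icc L H), u =ᶠ[𝓝 x] g := by
  obtain ⟨g, hg, hug⟩ := (lipschitzOnWith_interior_of_ae_norm_fderiv_le hu.convex
    (K := m) hu.ae_norm_fderiv_le).extend_real
  refine ⟨g, hg, (ae_mem_interior_of_convex hu.convex.1).mono fun x hx => ?_⟩
  exact hug.eventuallyEq_of_mem (isOpen_interior.mem_nhds hx)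

end FeasibleUtility

section UniformDistribution

/-- The uniform distribution on the unit cube `[0,1]^m`, the prior `𝒰^m` on the valuations. -/
noncomputable abbrev uniformCube (m : ℕ) : Measure (Fin m → ℝ) := Measure.pi fun _ => uniform01

theorem uniformCube_eq_restrict (m : ℕ) : uniformCube m = volume.restrict (Icc 0 1) := by
  rw [uniformCube, ← pi_univ_Icc, volume_pi, Measure.restrict_pi_pi]
  rfl

theorem uniformCube_restrict_Icc (m : ℕ) :
    (uniformCube m).restrict (Icc 0 1) = uniformCube m := by
  rw [uniformCube_eq_restrict, Measure.restrict_restrict measurableSet_Icc, inter_self]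

theorem ae_uniformCube_mem_Icc (m : ℕ) : ∀ᵐ x ∂uniformCube m, x ∈ Icc (0 : Fin m → ℝ) 1 := by
  rw [uniformCube_eq_restrict]
  exact ae_restrict_mem measurableSet_Icc

theorem integral_uniform01 (f : ℝ → ℝ) : ∫ t, f t ∂uniform01 = ∫ t in (0 : ℝ)..1, f t := by
  rw [uniform01, integral_Icc_eq_integral_Ioc, intervalIntegral.integral_of_le zero_le_one]

theorem uniform01_real_Ioi {a : ℝ} (ha : a ∈ Icc (0 : ℝ) 1) :
    uniform01.real (Ioi a) = 1 - a := by
  have hinter : Ioi a ∩ Icc 0 1 = Ioc a 1 := by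
    ext t
    simp only [mem_inter_iff, mem_Ioi, mem_Icc, mem_Ioc]
    exact ⟨fun h => ⟨h.1, h.2.2⟩, fun h => ⟨h.1, ha.1.trans h.1.le, h.2⟩⟩
  rw [uniform01, measureReal_restrict_apply measurableSet_Ioi, hinter,
    Real.volume_real_Ioc_of_le ha.2]

theorem measurable_ite_lt_apply {ι : Type*} (i : ι) (a c : ℝ) :
    Measurable fun x : ι → ℝ => if a < x i then c else 0 :=
  .ite (measurableSet_lt measurable_const (measurable_pi_apply i)) measurable_const
    measurable_const

theorem integral_ite_lt_apply_uniformCube {m : ℕ} (i : Fin m) {a : ℝ} (ha : a ∈ Icc (0 : ℝ) 1)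
    (c : ℝ) : ∫ x, (if a < x i then c else 0) ∂uniformCube m = (1 - a) * c := by
  have hind : (fun t : ℝ => if a < t then c else 0) = (Ioi a).indicator fun _ => c := by
    ext t
    simp [indicator]
  rw [integral_comp_eval (μ := fun _ : Fin m => uniform01) (i := i)
    (f := fun t : ℝ => if a < t then c else 0)
    (by rw [hind]; exact (measurable_const.indicator measurableSet_Ioi).aestronglyMeasurable),
    hind, integral_indicator_const c measurableSet_Ioi, uniform01_real_Ioi ha, smul_eq_mul]

end UniformDistribution

section LipschitzOnCube

variable {m : ℕ} {K : ℝ≥0} {g : (Fin m → ℝ) → ℝ}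

theorem integrable_uniformCube_of_continuous (hg : Continuous g) :
    Integrable g (uniformCube m) := by
  rw [uniformCube_eq_restrict]
  exact hg.continuousOn.integrableOn_compact isCompact_Icc

theorem integrable_partialDeriv (hg : LipschitzWith K g) (j : Fin m) :
    Integrable (partialDeriv g j) (uniformCube m) :=
  .of_bound (measurable_lineDeriv hg.continuous).aestronglyMeasurable _
    (.of_forall fun _ => norm_lineDeriv_le_of_lipschitz ℝ hg)

theorem integrable_inducedPayment_of_lipschitzWith (hg : LipschitzWith K g) :
    Integrable (inducedPayment g) (uniformCube m) := by
  refine (integrable_finsetSum _ fun j _ => ?_).sub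
    (integrable_uniformCube_of_continuous hg.continuous)
  refine (integrable_partialDeriv hg j).mul_bdd (c := 1)
    (measurable_pi_apply j).aestronglyMeasurable ?_
  filter_upwards [ae_uniformCube_mem_Icc m] with x hx
  rw [Real.norm_of_nonneg (hx.1 j)]
  exact hx.2 j

end LipschitzOnCube

/-- A certificate for the linear-programming dual of revenue maximization under the uniform prior
on the unit cube. The dual variable `dual j` of the constraint `∂u/∂xⱼ ≤ 1` climbs from `0` to `1`
along every line in direction `j`, and `slope j` is its derivative along these lines. It may jump in
the other coordinates, so `slope j` is carried as data: it has to be jointly measurable, and the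
line derivative of a discontinuous function need not be. -/
structure DualCertificate (m : ℕ) where
  dual : Fin m → (Fin m → ℝ) → ℝ
  slope : Fin m → (Fin m → ℝ) → ℝ
  bound : ℝ≥0
  measurable_dual : ∀ j, Measurable (dual j)
  measurable_slope : ∀ j, Measurable (slope j)
  dual_nonneg : ∀ j x, 0 ≤ dual j x
  dual_update_zero : ∀ j x, dual j (update x j 0) = 0
  dual_update_one : ∀ j x, dual j (update x j 1) = 1
  lipschitzWith_dual : ∀ j x, LipschitzWith bound (dual j ∘ update x j)
  hasDerivAt_dual : ∀ j x, ∀ᵐ t, HasDerivAt (dual j ∘ update x j) (slope j (update x j t)) t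
  abs_slope_le : ∀ j x, |slope j x| ≤ bound
  sum_slope_le : ∀ x, ∑ j, slope j x ≤ m + 1

theorem integral_sub_mul_deriv_add_eq_zero {z z' h : ℝ → ℝ} {K C : ℝ≥0}
    (hz : LipschitzWith K z) (hz0 : z 0 = 0) (hz1 : z 1 = 1)
    (hz' : ∀ᵐ t, HasDerivAt z (z' t) t) (hh : LipschitzWith C h) :
    ∫ t, ((t - z t) * deriv h t + (1 - z' t) * h t) ∂uniform01 = 0 := by
  have hid : LipschitzWith 1 fun t : ℝ => t := LipschitzWith.id
  have hac : AbsolutelyContinuousOnInterval (fun t => t - z t) 0 1 :=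
    ((hid.sub hz).lipschitzOnWith (s := uIcc 0 1)).absolutelyContinuousOnInterval
  have hparts := hac.integral_deriv_mul_eq_sub
    (hh.lipschitzOnWith (s := uIcc 0 1)).absolutelyContinuousOnInterval
  simp only [hz0, hz1, sub_self, zero_mul] at hparts
  rw [integral_uniform01]
  refine (intervalIntegral.integral_congr_ae ?_).trans hparts
  filter_upwards [hz'] with t ht _
  rw [((hasDerivAt_id' t).fun_sub ht).deriv]
  ring

namespace DualCertificate

variable {m : ℕ} (C : DualCertificate m) {K : ℝ≥0} {g : (Fin m → ℝ) → ℝ}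

theorem abs_dual_le {x : Fin m → ℝ} (hx : x ∈ Icc (0 : Fin m → ℝ) 1) (j : Fin m) :
    |C.dual j x| ≤ C.bound := by
  have hdist := (C.lipschitzWith_dual j x).dist_le_mul (x j) 0
  rw [comp_apply, comp_apply, update_eq_self, C.dual_update_zero, Real.dist_eq, Real.dist_eq,
    sub_zero, sub_zero, abs_of_nonneg (hx.1 j)] at hdist
  exact hdist.trans (mul_le_of_le_one_right C.bound.2 (hx.2 j))

theorem integrable_dual (j : Fin m) : Integrable (C.dual j) (uniformCube m) :=
  .of_bound (C.measurable_dual j).aestronglyMeasurable C.bound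
    ((ae_uniformCube_mem_Icc m).mono fun _ hx => C.abs_dual_le hx j)

/-- The objective of the dual problem: an upper bound on the revenue of every feasible utility. -/
noncomputable def value : ℝ := ∑ j, ∫ x, C.dual j x ∂uniformCube m

/-- The integrand of the integration by parts against `xⱼ - dual j` along the lines in
direction `j`. -/
noncomputable def lineTerm (g : (Fin m → ℝ) → ℝ) (j : Fin m) (x : Fin m → ℝ) : ℝ :=
  (x j - C.dual j x) * partialDeriv g j x + (1 - C.slope j x) * g x

theorem integrable_lineTerm (hg : LipschitzWith K g) (j : Fin m) :
    Integrable (C.lineTerm g j) (uniformCube m) := by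
  refine ((integrable_partialDeriv hg j).bdd_mul (c := 1 + C.bound)
    ((measurable_pi_apply j).sub (C.measurable_dual j)).aestronglyMeasurable ?_).add
    ((integrable_uniformCube_of_continuous hg.continuous).bdd_mul (c := 1 + C.bound)
      (measurable_const.sub (C.measurable_slope j)).aestronglyMeasurable ?_)
  · filter_upwards [ae_uniformCube_mem_Icc m] with x hx
    refine (norm_sub_le _ _).trans (add_le_add ?_ (C.abs_dual_le hx j))
    rw [Real.norm_of_nonneg (hx.1 j)]
    exact hx.2 j
  · refine .of_forall fun x => (norm_sub_le _ _).trans (add_le_add ?_ (C.abs_slope_le j x))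
    exact norm_one.le

theorem integral_lineTerm (hg : LipschitzWith K g) (j : Fin m) :
    ∫ x, C.lineTerm g j x ∂uniformCube m = 0 := by
  rw [← integral_integral_update _ j (C.integrable_lineTerm hg j)]
  refine integral_eq_zero_of_ae (.of_forall fun x => ?_)
  have hline := integral_sub_mul_deriv_add_eq_zero (C.lipschitzWith_dual j x)
    (C.dual_update_zero j x) (C.dual_update_one j x) (C.hasDerivAt_dual j x)
    (hg.comp (lipschitzWith_update x j))
  simpa only [lineTerm, update_self, deriv_comp_update, comp_apply, Pi.zero_apply] using hline

theorem inducedPayment_le {x : Fin m → ℝ} (hg : 0 ≤ g x) (hpartial : ∀ j, partialDeriv g j x ≤ 1) :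
    inducedPayment g x ≤ ∑ j, C.dual j x + ∑ j, C.lineTerm g j x := by
  have hsplit : inducedPayment g x = ∑ j, C.dual j x * partialDeriv g j x
      + (∑ j, C.slope j x - (m + 1)) * g x + ∑ j, C.lineTerm g j x := by
    simp only [inducedPayment, lineTerm, sub_mul, one_mul, Finset.sum_add_distrib,
      Finset.sum_sub_distrib, Finset.sum_mul, Finset.sum_const, Finset.card_univ,
      Fintype.card_fin, nsmul_eq_mul, mul_comm (x _)]
    ring
  have hdual : ∑ j, C.dual j x * partialDeriv g j x ≤ ∑ j, C.dual j x :=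
    Finset.sum_le_sum fun j _ => mul_le_of_le_one_right (C.dual_nonneg j x) (hpartial j)
  have hslope : (∑ j, C.slope j x - (m + 1)) * g x ≤ 0 :=
    mul_nonpos_of_nonpos_of_nonneg (sub_nonpos.2 (C.sum_slope_le x)) hg
  linarith

theorem integral_inducedPayment_le (hg : LipschitzWith K g) (hg0 : ∀ᵐ x ∂uniformCube m, 0 ≤ g x)
    (hpartial : ∀ᵐ x ∂uniformCube m, ∀ j, partialDeriv g j x ≤ 1) :
    ∫ x, inducedPayment g x ∂uniformCube m ≤ C.value := by
  have hdual : Integrable (fun x => ∑ j, C.dual j x) (uniformCube m) :=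
    integrable_finsetSum _ fun j _ => C.integrable_dual j
  have hline : Integrable (fun x => ∑ j, C.lineTerm g j x) (uniformCube m) :=
    integrable_finsetSum _ fun j _ => C.integrable_lineTerm hg j
  calc ∫ x, inducedPayment g x ∂uniformCube m
      ≤ ∫ x, (∑ j, C.dual j x + ∑ j, C.lineTerm g j x) ∂uniformCube m := by
        refine integral_mono_ae (integrable_inducedPayment_of_lipschitzWith hg) (hdual.add hline) ?_
        filter_upwards [hg0, hpartial] with x hx0 hx1 using C.inducedPayment_le hx0 hx1
    _ = C.value + ∑ j, ∫ x, C.lineTerm g j x ∂uniformCube m := by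
        rw [integral_add hdual hline, integral_finsetSum _ fun j _ => C.integrable_dual j,
          integral_finsetSum _ fun j _ => C.integrable_lineTerm hg j, value]
    _ = C.value := by simp only [C.integral_lineTerm hg, Finset.sum_const_zero, add_zero]

end DualCertificate

section Revenue

variable {m : ℕ} {u : (Fin m → ℝ) → ℝ}

theorem expectedRevenue_eq_integral_uniformCube (u : (Fin m → ℝ) → ℝ) :
    expectedRevenue 0 1 (fun _ => uniform01) u = ∫ x, inducedPayment u x ∂uniformCube m :=
  congrArg (fun μ => ∫ x, inducedPayment u x ∂μ) (uniformCube_restrict_Icc m)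

theorem inducedPayment_eq_of_eventuallyEq {g : (Fin m → ℝ) → ℝ} {x : Fin m → ℝ}
    (hug : u =ᶠ[𝓝 x] g) : inducedPayment u x = inducedPayment g x := by
  simp only [inducedPayment, partialDeriv, hug.lineDeriv_eq, hug.self_of_nhds]

theorem IsFeasibleUtility.integrable_inducedPayment (hu : IsFeasibleUtility 0 1 u) :
    Integrable (inducedPayment u) (uniformCube m) := by
  obtain ⟨g, hg, hug⟩ := hu.exists_lipschitzWith_eventuallyEq
  rw [← uniformCube_eq_restrict] at hug
  exact (integrable_inducedPayment_of_lipschitzWith hg).congr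
    (hug.mono fun x hx => (inducedPayment_eq_of_eventuallyEq hx).symm)

theorem IsFeasibleUtility.expectedRevenue_le_value (hu : IsFeasibleUtility 0 1 u)
    (C : DualCertificate m) : expectedRevenue 0 1 (fun _ => uniform01) u ≤ C.value := by
  obtain ⟨g, hg, hug⟩ := hu.exists_lipschitzWith_eventuallyEq
  have hpartial := ae_all_iff.2 hu.deriv_mem
  rw [← uniformCube_eq_restrict] at hug hpartial
  rw [expectedRevenue_eq_integral_uniformCube,
    integral_congr_ae (hug.mono fun x hx => inducedPayment_eq_of_eventuallyEq hx)]
  refine C.integral_inducedPayment_le hg ?_ ?_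
  · filter_upwards [hug, ae_uniformCube_mem_Icc m] with x hx hmem
    exact hx.self_of_nhds ▸ hu.nonneg x hmem
  · filter_upwards [hug, hpartial] with x hx hx' j
    rw [partialDeriv, ← hx.lineDeriv_eq]
    exact (hx' j).2

theorem isFeasibleUtility_zero (L H : Fin m → ℝ) : IsFeasibleUtility L H 0 where
  nonneg _ _ := le_rfl
  convex := convexOn_const 0 (convex_Icc L H)
  deriv_mem j := .of_forall fun x => by simp [partialDeriv, lineDeriv]

theorem Rev_le_value (C : DualCertificate m) :
    Rev (0 : Fin m → ℝ) 1 (fun _ => uniform01) ≤ C.value := by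
  refine csSup_le ⟨_, 0, isFeasibleUtility_zero 0 1, rfl⟩ ?_
  rintro _ ⟨u, hu, rfl⟩
  exact hu.expectedRevenue_le_value C

theorem IsFeasibleUtility.expectedRevenue_le_Rev (hu : IsFeasibleUtility 0 1 u)
    (C : DualCertificate m) : expectedRevenue 0 1 (fun _ => uniform01) u
      ≤ Rev (0 : Fin m → ℝ) 1 (fun _ => uniform01) := by
  refine le_csSup ⟨C.value, ?_⟩ ⟨u, hu, rfl⟩
  rintro _ ⟨v, hv, rfl⟩
  exact hv.expectedRevenue_le_value C

end Revenue

section Ramp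

/-- The ramp of slope `s` that ends at height `1` at `t = 1`. -/
def ramp (s t : ℝ) : ℝ := max 0 (1 - s * (1 - t))

/-- The slope of `ramp s` at `t`, except at its kink. -/
noncomputable def rampSlope (s t : ℝ) : ℝ := if 0 < 1 - s * (1 - t) then s else 0

variable {s t : ℝ}

theorem ramp_nonneg (s t : ℝ) : 0 ≤ ramp s t := le_max_left _ _

theorem ramp_zero (hs : 1 ≤ s) : ramp s 0 = 0 := max_eq_left (by linarith)

theorem ramp_one (s : ℝ) : ramp s 1 = 1 := by simp [ramp]

theorem lipschitzWith_ramp {K : ℝ≥0} (hs : |s| ≤ K) : LipschitzWith K (ramp s) := by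
  refine LipschitzWith.const_max (.of_dist_le_mul fun a b => ?_) 0
  have hsub : 1 - s * (1 - a) - (1 - s * (1 - b)) = s * (a - b) := by ring
  rw [Real.dist_eq, Real.dist_eq, hsub, abs_mul]
  gcongr

theorem abs_rampSlope_le (s t : ℝ) : |rampSlope s t| ≤ |s| := by
  unfold rampSlope
  split_ifs <;> simp

theorem rampSlope_le (hs : 0 ≤ s) (t : ℝ) : rampSlope s t ≤ s :=
  (le_abs_self _).trans ((abs_rampSlope_le s t).trans_eq (abs_of_nonneg hs))

theorem rampSlope_eq_zero (h : 1 ≤ s * (1 - t)) : rampSlope s t = 0 :=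
  if_neg (by linarith)

theorem measurable_ramp {α : Type*} [MeasurableSpace α] {f g : α → ℝ} (hf : Measurable f)
    (hg : Measurable g) : Measurable fun x => ramp (f x) (g x) := by
  unfold ramp
  fun_prop

theorem measurable_rampSlope {α : Type*} [MeasurableSpace α] {f g : α → ℝ} (hf : Measurable f)
    (hg : Measurable g) : Measurable fun x => rampSlope (f x) (g x) :=
  Measurable.ite (measurableSet_lt measurable_const (by fun_prop)) hf measurable_const

theorem hasDerivAt_ramp (h : 1 - s * (1 - t) ≠ 0) : HasDerivAt (ramp s) (rampSlope s t) t := by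
  have hcont : Continuous fun r : ℝ => 1 - s * (1 - r) := by fun_prop
  have hlin : HasDerivAt (fun r : ℝ => 1 - s * (1 - r)) s t := by
    simpa using (((hasDerivAt_id t).const_sub 1).const_mul s).const_sub 1
  obtain hneg | hpos := h.lt_or_gt
  · rw [rampSlope, if_neg hneg.not_gt]
    refine (hasDerivAt_const t (0 : ℝ)).congr_of_eventuallyEq ?_
    filter_upwards [hcont.continuousAt.eventually_lt_const hneg] with r hr
    exact max_eq_left hr.le
  · rw [rampSlope, if_pos hpos]
    refine hlin.congr_of_eventuallyEq ?_
    filter_upwards [hcont.continuousAt.eventually_const_lt hpos] with r hr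
    exact max_eq_right hr.le

theorem countable_kink_ramp (s : ℝ) : {t | 1 - s * (1 - t) = 0}.Countable := by
  refine Subsingleton.countable fun a ha b hb => ?_
  rw [mem_ofPred_eq] at ha hb
  have hs : s ≠ 0 := by rintro rfl; simp at ha
  exact sub_right_injective (mul_left_cancel₀ hs (by linarith : s * (1 - a) = s * (1 - b)))

theorem ae_hasDerivAt_ramp (s : ℝ) : ∀ᵐ t, HasDerivAt (ramp s) (rampSlope s t) t :=
  ((countable_kink_ramp s).ae_notMem volume).mono fun _ ht => hasDerivAt_ramp ht

theorem integral_ramp (hs : 1 ≤ s) : ∫ t, ramp s t ∂uniform01 = 1 / (2 * s) := by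
  have hcont : Continuous (ramp s) := (lipschitzWith_ramp (K := ‖s‖₊) le_rfl).continuous
  have hderiv : ∀ t ∈ Ioo (0 : ℝ) 1 \ {t | 1 - s * (1 - t) = 0},
      HasDerivAt (fun t => ramp s t ^ 2 / (2 * s)) (ramp s t) t := fun t ht => by
    refine (((hasDerivAt_ramp ht.2).pow 2).div_const (2 * s)).congr_deriv ?_
    rw [ramp, rampSlope]
    split_ifs with hpos
    · rw [max_eq_right hpos.le]
      field_simp
      ring
    · rw [max_eq_left (not_lt.1 hpos)]
      simp
  rw [integral_uniform01, MeasureTheory.integral_eq_of_hasDerivAt_off_countable_of_le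
    (fun t => ramp s t ^ 2 / (2 * s)) _ zero_le_one (countable_kink_ramp s) (by fun_prop) hderiv
    (hcont.intervalIntegrable 0 1), ramp_one, ramp_zero hs]
  simp

end Ramp

section UniformCertificate

variable {m : ℕ}

/-- The goods valued above `1 / (m + 1)`, the point where the steepest ramp starts. -/
noncomputable def highGoods (x : Fin m → ℝ) : Finset (Fin m) := {i | 1 / ((m : ℝ) + 1) < x i}

/-- The slope of the dual variable of good `j`: the ramps of any `k` high goods share the total
slope `m + 1`. Inserting `j` makes the slope constant along lines in direction `j`. -/
noncomputable def dualSlope (j : Fin m) (x : Fin m → ℝ) : ℝ :=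
  (m + 1) / (insert j (highGoods x)).card

theorem mem_highGoods {x : Fin m → ℝ} {i : Fin m} :
    i ∈ highGoods x ↔ 1 / ((m : ℝ) + 1) < x i := by
  simp [highGoods]

theorem insert_highGoods_update (j : Fin m) (x : Fin m → ℝ) (t : ℝ) :
    insert j (highGoods (update x j t)) = insert j (highGoods x) := by
  ext i
  obtain rfl | hij := eq_or_ne i j
  · simp
  · simp [mem_highGoods, hij]

theorem dualSlope_update (j : Fin m) (x : Fin m → ℝ) (t : ℝ) :
    dualSlope j (update x j t) = dualSlope j x := by
  rw [dualSlope, insert_highGoods_update, dualSlope]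

theorem card_insert_highGoods_pos (j : Fin m) (x : Fin m → ℝ) :
    (0 : ℝ) < (insert j (highGoods x)).card :=
  Nat.cast_pos.2 (Finset.insert_nonempty j _).card_pos

theorem card_insert_highGoods_le (j : Fin m) (x : Fin m → ℝ) :
    ((insert j (highGoods x)).card : ℝ) ≤ m :=
  Nat.cast_le.2 (card_finset_fin_le _)

theorem one_le_dualSlope (j : Fin m) (x : Fin m → ℝ) : 1 ≤ dualSlope j x := by
  rw [dualSlope, one_le_div (card_insert_highGoods_pos j x)]
  linarith [card_insert_highGoods_le j x]

theorem abs_dualSlope_le (j : Fin m) (x : Fin m → ℝ) : |dualSlope j x| ≤ m + 1 := by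
  rw [abs_of_nonneg (zero_le_one.trans (one_le_dualSlope j x)), dualSlope]
  exact div_le_self (by positivity)
    (Nat.one_le_cast.2 (Finset.insert_nonempty j (highGoods x)).card_pos)

theorem card_insert_highGoods_eq_sum (j : Fin m) (x : Fin m → ℝ) :
    ((insert j (highGoods x)).card : ℝ)
      = 1 + ∑ i ∈ Finset.univ.erase j, if 1 / ((m : ℝ) + 1) < x i then 1 else 0 := by
  have herase : (insert j (highGoods x)).erase j
      = {i ∈ Finset.univ.erase j | 1 / ((m : ℝ) + 1) < x i} := by
    ext i
    simp [mem_highGoods]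
  rw [← Finset.card_erase_add_one (Finset.mem_insert_self j _), herase, Finset.sum_boole,
    Nat.cast_add, Nat.cast_one, add_comm]

theorem measurable_dualSlope (j : Fin m) : Measurable (dualSlope j) := by
  unfold dualSlope
  simp only [card_insert_highGoods_eq_sum]
  exact measurable_const.div (measurable_const.add
    (Finset.measurable_fun_sum _ fun i _ => measurable_ite_lt_apply i _ 1))

theorem rampSlope_dualSlope_of_notMem {x : Fin m → ℝ} {j : Fin m} (hj : j ∉ highGoods x) :
    rampSlope (dualSlope j x) (x j) = 0 := by
  refine rampSlope_eq_zero ?_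
  have hcard := card_insert_highGoods_pos j x
  have hlow : (m : ℝ) ≤ (m + 1) * (1 - x j) := by
    have hxj := not_lt.1 (mem_highGoods.not.1 hj)
    rw [le_div_iff₀ (by positivity)] at hxj
    linarith
  rw [dualSlope, div_mul_eq_mul_div, one_le_div hcard]
  exact (card_insert_highGoods_le j x).trans hlow

theorem sum_rampSlope_dualSlope_le (x : Fin m → ℝ) :
    ∑ j, rampSlope (dualSlope j x) (x j) ≤ m + 1 := by
  calc ∑ j, rampSlope (dualSlope j x) (x j)
      = ∑ j ∈ highGoods x, rampSlope (dualSlope j x) (x j) :=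
        (Finset.sum_subset (Finset.subset_univ _) fun j _ hj =>
          rampSlope_dualSlope_of_notMem hj).symm
    _ ≤ ∑ _j ∈ highGoods x, ((m : ℝ) + 1) / (highGoods x).card := by
        refine Finset.sum_le_sum fun j hj => ?_
        refine (rampSlope_le (zero_le_one.trans (one_le_dualSlope j x)) (x j)).trans_eq ?_
        rw [dualSlope, Finset.insert_eq_of_mem hj]
    _ ≤ m + 1 := by
        rw [Finset.sum_const, nsmul_eq_mul]
        rw [mul_div_left_comm]
        exact mul_le_of_le_one_right (by positivity) (div_self_le_one _)

/-- The certificate for the bound of the theorem: the dual variable of good `j` is the ramp of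
slope `dualSlope j`. -/
noncomputable def uniformCertificate (m : ℕ) : DualCertificate m where
  dual j x := ramp (dualSlope j x) (x j)
  slope j x := rampSlope (dualSlope j x) (x j)
  bound := m + 1
  measurable_dual j := measurable_ramp (measurable_dualSlope j) (measurable_pi_apply j)
  measurable_slope j := measurable_rampSlope (measurable_dualSlope j) (measurable_pi_apply j)
  dual_nonneg _ _ := ramp_nonneg _ _
  dual_update_zero j x := by rw [update_self, ramp_zero (one_le_dualSlope _ _)]
  dual_update_one j x := by rw [update_self, ramp_one]
  lipschitzWith_dual j x := by
    simpa [comp_def, dualSlope_update] using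
      lipschitzWith_ramp (K := m + 1) (by simpa using abs_dualSlope_le j x)
  hasDerivAt_dual j x := by
    simpa [comp_def, dualSlope_update] using ae_hasDerivAt_ramp (dualSlope j x)
  abs_slope_le j x := (abs_rampSlope_le _ _).trans (by simpa using abs_dualSlope_le j x)
  sum_slope_le := sum_rampSlope_dualSlope_le

theorem integral_card_insert_highGoods (j : Fin m) :
    ∫ x, ((insert j (highGoods x)).card : ℝ) ∂uniformCube m
      = (1 + (m : ℝ) ^ 2) / (m + 1) := by
  have hm : ((Finset.univ.erase j).card : ℝ) = m - 1 := by
    rw [Finset.card_erase_of_mem (Finset.mem_univ j), Finset.card_univ, Fintype.card_fin,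
      Nat.cast_pred j.pos]
  have hthreshold : 1 / ((m : ℝ) + 1) ∈ Icc (0 : ℝ) 1 :=
    ⟨by positivity, div_le_self zero_le_one (by simp)⟩
  have hint : ∀ i : Fin m,
      Integrable (fun x : Fin m → ℝ => if 1 / ((m : ℝ) + 1) < x i then (1 : ℝ) else 0)
        (uniformCube m) := fun i =>
    .of_bound (measurable_ite_lt_apply i _ 1).aestronglyMeasurable 1
      (.of_forall fun x => by split_ifs <;> simp)
  simp only [card_insert_highGoods_eq_sum]
  rw [integral_add (integrable_const _) (integrable_finsetSum _ fun i _ => hint i),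
    integral_finsetSum _ fun i _ => hint i]
  simp only [integral_ite_lt_apply_uniformCube _ hthreshold, integral_const, probReal_univ,
    Finset.sum_const, nsmul_eq_mul, hm, smul_eq_mul]
  field_simp
  ring

theorem integral_dual_uniformCertificate (j : Fin m) :
    ∫ x, (uniformCertificate m).dual j x ∂uniformCube m
      = (1 + (m : ℝ) ^ 2) / (2 * (1 + (m : ℝ)) ^ 2) := by
  have hramp : ∀ x, ∫ t, (uniformCertificate m).dual j (update x j t) ∂uniform01
      = (insert j (highGoods x)).card * (1 / (2 * (m + 1))) := fun x => by
    simp only [uniformCertificate, dualSlope_update, update_self]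
    rw [integral_ramp (one_le_dualSlope j x), dualSlope]
    have hcard := (card_insert_highGoods_pos j x).ne'
    field_simp
  rw [← integral_integral_update _ j ((uniformCertificate m).integrable_dual j)]
  simp only [hramp]
  rw [integral_mul_const, integral_card_insert_highGoods]
  field_simp
  ring

theorem uniformCertificate_value (m : ℕ) :
    (uniformCertificate m).value = m * (1 + (m : ℝ) ^ 2) / (2 * (1 + (m : ℝ)) ^ 2) := by
  simp only [DualCertificate.value, integral_dual_uniformCertificate, Finset.sum_const,
    Finset.card_univ, Fintype.card_fin, nsmul_eq_mul, mul_div_assoc]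

end UniformCertificate

namespace Mechanism

variable {m : ℕ} {L H : Fin m → ℝ} {M : Mechanism L H}

/-- The utility of a buyer with valuations `x` who reports them truthfully. -/
def truthfulUtility (M : Mechanism L H) (x : Fin m → ℝ) : ℝ := M.utility x x

theorem utility_smul_add_smul (M : Mechanism L H) (x' x y : Fin m → ℝ) {a b : ℝ}
    (hab : a + b = 1) : M.utility x' (a • x + b • y) = a * M.utility x' x + b * M.utility x' y := by
  have hsum : ∑ j, M.alloc x' j * (a • x + b • y) j
      = a * ∑ j, M.alloc x' j * x j + b * ∑ j, M.alloc x' j * y j := by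
    simp only [Finset.mul_sum, ← Finset.sum_add_distrib, Pi.add_apply, Pi.smul_apply, smul_eq_mul]
    exact Finset.sum_congr rfl fun j _ => by ring
  rw [utility, utility, utility, hsum]
  linear_combination M.pay x' * hab

theorem hasLineDerivAt_utility (M : Mechanism L H) (x' x : Fin m → ℝ) (j : Fin m) :
    HasLineDerivAt ℝ (M.utility x') (M.alloc x' j) x (Pi.single j 1) := by
  have hline : ∀ t : ℝ, M.utility x' (x + t • Pi.single j 1)
      = M.utility x' x + t * M.alloc x' j := fun t => by
    have hsum : ∑ i, M.alloc x' i * (t • Pi.single j 1 : Fin m → ℝ) i = t * M.alloc x' j := by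
      simp [Pi.single_apply, mul_comm]
    simp only [utility, Pi.add_apply, mul_add, Finset.sum_add_distrib, hsum]
    ring
  simp only [HasLineDerivAt, hline]
  simpa using ((hasDerivAt_id (0 : ℝ)).mul_const (M.alloc x' j)).const_add (M.utility x' x)

theorem IncentiveCompatible.convexOn_truthfulUtility (hM : M.IncentiveCompatible) :
    ConvexOn ℝ (Icc L H) M.truthfulUtility := by
  refine ⟨convex_Icc L H, fun x hx y hy a b ha hb hab => ?_⟩
  have hz : a • x + b • y ∈ Icc L H := convex_Icc L H hx hy ha hb hab
  calc M.truthfulUtility (a • x + b • y)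
      = a * M.utility (a • x + b • y) x + b * M.utility (a • x + b • y) y :=
        M.utility_smul_add_smul _ x y hab
    _ ≤ a • M.truthfulUtility x + b • M.truthfulUtility y :=
        add_le_add (mul_le_mul_of_nonneg_left (hM x hx _ hz) ha)
          (mul_le_mul_of_nonneg_left (hM y hy _ hz) hb)

theorem IncentiveCompatible.partialDeriv_truthfulUtility (hM : M.IncentiveCompatible)
    {x : Fin m → ℝ} (hx : x ∈ interior (Icc L H)) (hdiff : DifferentiableAt ℝ M.truthfulUtility x)
    (j : Fin m) : partialDeriv M.truthfulUtility j x = M.alloc x j := by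
  have hmin : IsLocalMin (fun y => M.truthfulUtility y - M.utility x y) x := by
    filter_upwards [mem_interior_iff_mem_nhds.1 hx] with y hy
    have hxx : M.truthfulUtility x - M.utility x x = 0 := sub_self _
    rw [hxx]
    exact sub_nonneg.2 (hM y hy x (interior_subset hx))
  have hline : HasLineDerivAt ℝ (fun y => M.truthfulUtility y - M.utility x y)
      (partialDeriv M.truthfulUtility j x - M.alloc x j) x (Pi.single j 1) :=
    HasDerivAt.fun_sub hdiff.lineDifferentiableAt.hasLineDerivAt (M.hasLineDerivAt_utility x x j)
  exact sub_eq_zero.1 (hmin.hasLineDerivAt_eq_zero hline)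

theorem IncentiveCompatible.ae_partialDeriv_truthfulUtility (hM : M.IncentiveCompatible) :
    ∀ᵐ x ∂volume.restrict (Icc L H), ∀ j, partialDeriv M.truthfulUtility j x = M.alloc x j := by
  filter_upwards [ae_mem_interior_of_convex (convex_Icc L H),
    ae_differentiableAt_of_convexOn hM.convexOn_truthfulUtility] with x hx hdiff
  exact hM.partialDeriv_truthfulUtility hx hdiff

theorem IncentiveCompatible.isFeasibleUtility_truthfulUtility (hM : M.IncentiveCompatible)
    (hR : M.IndividuallyRational) : IsFeasibleUtility L H M.truthfulUtility where
  nonneg := hR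
  convex := hM.convexOn_truthfulUtility
  deriv_mem j := by
    filter_upwards [hM.ae_partialDeriv_truthfulUtility, ae_restrict_mem measurableSet_Icc]
      with x hpartial hx
    exact hpartial j ▸ M.alloc_mem x hx j

theorem IncentiveCompatible.inducedPayment_truthfulUtility_ae_eq (hM : M.IncentiveCompatible) :
    inducedPayment M.truthfulUtility =ᵐ[volume.restrict (Icc L H)] M.pay := by
  filter_upwards [hM.ae_partialDeriv_truthfulUtility] with x hx
  simp only [inducedPayment, hx, truthfulUtility, utility, sub_sub_cancel]

theorem IncentiveCompatible.integrable_pay {M : Mechanism (0 : Fin m → ℝ) 1}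
    (hM : M.IncentiveCompatible) (hR : M.IndividuallyRational) :
    Integrable M.pay (uniformCube m) := by
  refine (hM.isFeasibleUtility_truthfulUtility hR).integrable_inducedPayment.congr ?_
  rw [uniformCube_eq_restrict]
  exact hM.inducedPayment_truthfulUtility_ae_eq

theorem IncentiveCompatible.expectedRevenue_truthfulUtility {M : Mechanism (0 : Fin m → ℝ) 1}
    (hM : M.IncentiveCompatible) :
    expectedRevenue 0 1 (fun _ => uniform01) M.truthfulUtility
      = M.expectedPayment fun _ => uniform01 := by
  refine integral_congr_ae ?_
  rw [uniformCube_restrict_Icc, uniformCube_eq_restrict]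
  exact hM.inducedPayment_truthfulUtility_ae_eq

/-- The mechanism that offers a single good at the price `p`. -/
noncomputable def postedPrice {p : ℝ} (hp : 0 ≤ p) : Mechanism (0 : Fin 1 → ℝ) 1 where
  alloc x _ := if p < x 0 then 1 else 0
  pay x := if p < x 0 then p else 0
  alloc_mem x _ _ := by split_ifs <;> simp
  pay_nonneg x _ := by split_ifs <;> simp [hp]

variable {p : ℝ} (hp : 0 ≤ p)

theorem utility_postedPrice (x' x : Fin 1 → ℝ) :
    (postedPrice hp).utility x' x = if p < x' 0 then x 0 - p else 0 := by
  simp only [utility, postedPrice, Finset.univ_unique, Fin.default_eq_zero, Finset.sum_singleton]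
  split_ifs <;> ring

theorem individuallyRational_postedPrice : (postedPrice hp).IndividuallyRational := by
  intro x _
  rw [utility_postedPrice]
  split_ifs <;> linarith

theorem incentiveCompatible_postedPrice : (postedPrice hp).IncentiveCompatible := by
  intro x _ x' _
  rw [utility_postedPrice, utility_postedPrice]
  split_ifs <;> linarith

theorem expectedPayment_postedPrice (hp1 : p ≤ 1) :
    (postedPrice hp).expectedPayment (fun _ => uniform01) = (1 - p) * p := by
  rw [expectedPayment, uniformCube_restrict_Icc]
  exact integral_ite_lt_apply_uniformCube 0 ⟨hp, hp1⟩ p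

end Mechanism

theorem Rev_one : Rev (0 : Fin 1 → ℝ) 1 (fun _ => uniform01) = 1 / 4 := by
  refine le_antisymm ?_ ?_
  · refine (Rev_le_value (uniformCertificate 1)).trans_eq ?_
    rw [uniformCertificate_value]
    norm_num
  · have hhalf : (0 : ℝ) ≤ 1 / 2 := by norm_num
    have hIC := Mechanism.incentiveCompatible_postedPrice hhalf
    calc (1 / 4 : ℝ)
        = (Mechanism.postedPrice hhalf).expectedPayment fun _ => uniform01 := by
          rw [Mechanism.expectedPayment_postedPrice hhalf (by norm_num)]
          norm_num
      _ = expectedRevenue 0 1 (fun _ => uniform01)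
            (Mechanism.postedPrice hhalf).truthfulUtility :=
          hIC.expectedRevenue_truthfulUtility.symm
      _ ≤ Rev (0 : Fin 1 → ℝ) 1 fun _ => uniform01 :=
          (hIC.isFeasibleUtility_truthfulUtility
            (Mechanism.individuallyRational_postedPrice hhalf)).expectedRevenue_le_Rev
              (uniformCertificate 1)

theorem SRev_uniform01 (m : ℕ) : SRev (0 : Fin m → ℝ) 1 (fun _ => uniform01) = m / 4 := by
  have hRev : ∀ j : Fin m, Rev (m := 1) (fun _ => (0 : Fin m → ℝ) j)
      (fun _ => (1 : Fin m → ℝ) j) (fun _ => uniform01) = 1 / 4 := fun _ => Rev_one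
  rw [SRev, Finset.sum_congr rfl fun j _ => hRev j]
  simp [div_eq_mul_inv]

end GoodsMonopoly

theorem mainTheorem3 (m : ℕ) (hm : 1 ≤ m) :
    -- every truthful, individually rational mechanism
    (∀ M : GoodsMonopoly.Mechanism (0 : Fin m → ℝ) 1,
      M.IndividuallyRational → M.IncentiveCompatible →
        IntegrableOn M.pay (Icc 0 1) (Measure.pi fun _ => GoodsMonopoly.uniform01) ∧
        M.expectedPayment (fun _ => GoodsMonopoly.uniform01)
          ≤ m * (1 + (m : ℝ) ^ 2) / (2 * (1 + (m : ℝ)) ^ 2)) ∧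
    -- every feasible utility function
    (∀ u : (Fin m → ℝ) → ℝ, GoodsMonopoly.IsFeasibleUtility 0 1 u →
      IntegrableOn (GoodsMonopoly.inducedPayment u) (Icc 0 1)
        (Measure.pi fun _ => GoodsMonopoly.uniform01) ∧
      GoodsMonopoly.expectedRevenue 0 1 (fun _ => GoodsMonopoly.uniform01) u
        ≤ m * (1 + (m : ℝ) ^ 2) / (2 * (1 + (m : ℝ)) ^ 2)) ∧
    -- the optimal revenue
    GoodsMonopoly.Rev (0 : Fin m → ℝ) 1 (fun _ => GoodsMonopoly.uniform01)
      ≤ m * (1 + (m : ℝ) ^ 2) / (2 * (1 + (m : ℝ)) ^ 2) ∧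
    -- comparison with selling the goods separately
    GoodsMonopoly.SRev (0 : Fin m → ℝ) 1 (fun _ => GoodsMonopoly.uniform01) = m / 4 ∧
    GoodsMonopoly.Rev (0 : Fin m → ℝ) 1 (fun _ => GoodsMonopoly.uniform01) /
        GoodsMonopoly.SRev (0 : Fin m → ℝ) 1 (fun _ => GoodsMonopoly.uniform01)
      ≤ 2 * (1 + (m : ℝ) ^ 2) / (1 + (m : ℝ)) ^ 2 ∧
    2 * (1 + (m : ℝ) ^ 2) / (1 + (m : ℝ)) ^ 2 < 2 := by
  have hm0 : (0 : ℝ) < m := by exact_mod_cast hm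
  have hvalue := GoodsMonopoly.uniformCertificate_value m
  have hfeasible := fun u (hu : GoodsMonopoly.IsFeasibleUtility (0 : Fin m → ℝ) 1 u) =>
    (hu.expectedRevenue_le_value (GoodsMonopoly.uniformCertificate m)).trans_eq hvalue
  have hRev := (GoodsMonopoly.Rev_le_value (GoodsMonopoly.uniformCertificate m)).trans_eq hvalue
  refine ⟨fun M hR hM => ⟨(hM.integrable_pay hR).integrableOn, ?_⟩,
    fun u hu => ⟨hu.integrable_inducedPayment.integrableOn, hfeasible u hu⟩, hRev,
    GoodsMonopoly.SRev_uniform01 m, ?_, ?_⟩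
  · rw [← hM.expectedRevenue_truthfulUtility]
    exact hfeasible _ (hM.isFeasibleUtility_truthfulUtility hR)
  · rw [GoodsMonopoly.SRev_uniform01, div_le_iff₀ (by positivity)]
    refine hRev.trans_eq ?_
    field_simp
    ring
  · rw [div_lt_iff₀ (by positivity)]
    nlinarith
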